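/- Let $m\neq\pm1$ be a square-free integer, let $n_1,n_2\ge 2$ be coprime integers and $n=n_1n_2$. Let $\alpha,\alpha_1,\alpha_2\in\mathbb{C}$ satisfy $\alpha^{n}=\alpha_1^{n_1}=\alpha_2^{n_2}=m$, and put $M=\mathbb{Q}(\alpha)$, $M_1=\mathbb{Q}(\alpha_1)$, $M_2=\mathbb{Q}(\alpha_2)$. An integral basis of a number field is a $\mathbb{Z}$-basis of its ring of integers. The denominator of $p\in\mathbb{Q}[X]$ is the smallest positive integer $c$ with $c\,p\in\mathbb{Z}[X]$. Let $\psi_0=1,\psi_1,\dots,\psi_{n_1-1}\in\mathbb{Q}[X]$ and $\omega_0=1,\omega_1,\dots,\omega_{n_2-1}\in\mathbb{Q}[X]$ be polynomials with $\deg\psi_i=i$ and $\deg\omega_i=i$ such that $(\psi_0(\alpha_1),\dots,\psi_{n_1-1}(\alpha_1))$ is an integral basis of $M_1$ and $(\omega_0(\alpha_2),\dots,\omega_{n_2-1}(\alpha_2))$ is an integral basis of $M_2$. Put $$\Psi_{i,j}(X)=X^j\psi_i(X^{n_2})\quad(0\le i<n_1,\ 0\le j<n_2),\qquad \Omega_{i,j}(X)=X^j\omega_i(X^{n_1})\quad(0\le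 i<n_2,\ 0\le j<n_1).$$ (1) For every $k\in\{0,\dots,n-1\}$ there are a unique pair $(a,b)$ and a unique pair $(c,d)$ with $0\le a,d<n_1$ and $0\le b,c<n_2$ such that $\deg\Psi_{a,b}=\deg\Omega_{c,d}=k$. With these $a,b,c,d$, let $u$ be the denominator of $\Psi_{a,b}$ and $v$ the denominator of $\Omega_{c,d}$. Call $\gamma_k\in\mathbb{Q}[X]$ admissible for $k$ if $\deg\gamma_k=k$, the leading coefficient of $\gamma_k$ has the form $1/N$ with $N$ a nonzero integer, and $$v\,\gamma_k-\Psi_{a,b}\in\mathbb{Z}[X],\qquad u\,\gamma_k-\Omega_{c,d}\in\mathbb{Z}[X].$$ (2) If $\gamma_k$ is admissible for $k$ for every $k\in\{0,\dots,n-1\}$, then $(\gamma_0(\alpha),\gamma_1(\alpha),\dots,\gamma_{n-1}(\alpha))$ is an integral basis of $M$. (3) If all $\psi_i$ and all $\omega_i$ have positive leading coefficients (which can be achieved by changing signs), then an admissible $\gamma_k$ exists for every $k\in\{0,\dots,n-1\}$. -/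

import Mathlib

open Polynomial NumberField IntermediateField

/-- The finite family `b` of complex numbers is an integral basis of the number field `M ⊆ ℂ`:
it is a `ℤ`-basis of the ring of integers of `M`. -/
def IsIntegralBasis {ι : Type*} (M : IntermediateField ℚ ℂ) (b : ι → ℂ) : Prop :=
  ∃ B : Module.Basis ι ℤ (𝓞 M), ∀ i, (((B i : 𝓞 M) : M) : ℂ) = b i

/-- The rational polynomial `p` lies in `ℤ[X]`. -/
def HasIntCoeffs (p : ℚ[X]) : Prop :=
  ∃ q : ℤ[X], q.map (Int.castRingHom ℚ) = p

/-- The denominator of `p ∈ ℚ[X]`: the smallest positive integer `c` with `c · p ∈ ℤ[X]`. -/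
noncomputable def polyDenom (p : ℚ[X]) : ℕ :=
  sInf {c : ℕ | 0 < c ∧ HasIntCoeffs (C (c : ℚ) * p)}

/-- The set whose infimum defines `polyDenom` is never empty, so the infimum is a minimum. -/
theorem polyDenom_isLeast (p : ℚ[X]) :
    IsLeast {c : ℕ | 0 < c ∧ HasIntCoeffs (C (c : ℚ) * p)} (polyDenom p) := by
  have hne : {c : ℕ | 0 < c ∧ HasIntCoeffs (C (c : ℚ) * p)}.Nonempty := by
    obtain ⟨b, hb, h⟩ := IsLocalization.integerNormalization_spec (nonZeroDivisors ℤ) p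
    have hb0 : b ≠ 0 := nonZeroDivisors.ne_zero hb
    refine ⟨b.natAbs, Int.natAbs_pos.mpr hb0,
      C b.sign * IsLocalization.integerNormalization (nonZeroDivisors ℤ) p, ?_⟩
    have h' : (IsLocalization.integerNormalization (nonZeroDivisors ℤ) p).map
        (Int.castRingHom ℚ) = b • p := h
    have hs : ((b.sign : ℤ) : ℚ) * (b : ℚ) = ((b.natAbs : ℕ) : ℚ) := by
      rw [← Int.cast_mul, Int.sign_mul_self_eq_natAbs, Int.cast_natCast]
    ext i
    rw [Polynomial.map_mul, h', map_C]
    rw [coeff_C_mul, coeff_C_mul, coeff_smul, zsmul_eq_mul, eq_intCast, ← mul_assoc, hs]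
  exact ⟨Nat.sInf_mem hne, fun c hc => Nat.sInf_le hc⟩

/-- The polynomial `X ^ j * p (X ^ e)`. -/
noncomputable def extendPoly (e j : ℕ) (p : ℚ[X]) : ℚ[X] :=
  X ^ j * p.comp (X ^ e)

/-- `g` is a polynomial of degree `k` obtained from the families `ψ` and `ω` by the Chinese
remainder theorem on the denominators. With `Ψ = X ^ b * ψ a (X ^ n₂)` and
`Ω = X ^ d * ω c (X ^ n₁)` the members of degree `k` of the two extended families, and `u`, `v`
their denominators, both `v * g - Ψ` and `u * g - Ω` lie in `ℤ[X]`.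
The leading coefficient of `g` is normalized to be the reciprocal of an integer. -/
structure IsCRTCombination {n₁ n₂ : ℕ} (ψ : Fin n₁ → ℚ[X]) (ω : Fin n₂ → ℚ[X]) (k : ℕ)
    (g : ℚ[X]) : Prop where
  degree_eq : g.degree = k
  leadingCoeff_eq : ∃ N : ℤ, N ≠ 0 ∧ g.leadingCoeff = 1 / (N : ℚ)
  sub_mem : ∀ (a : Fin n₁) (b : Fin n₂) (c : Fin n₂) (d : Fin n₁),
    (extendPoly n₂ b (ψ a)).degree = k → (extendPoly n₁ d (ω c)).degree = k →
      HasIntCoeffs (C (polyDenom (extendPoly n₁ d (ω c)) : ℚ) * g - extendPoly n₂ b (ψ a)) ∧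
      HasIntCoeffs (C (polyDenom (extendPoly n₂ b (ψ a)) : ℚ) * g - extendPoly n₁ d (ω c))

/-! For polynomials `γ k` of degree `k` with integral values at `α`, being an integral basis is a
condition on leading coefficients: every `P` of degree `k < n` with `P(α)` integral must have
leading coefficient in `ℤ · lc(γ k)` (`isIntegralBasis_of_leadingCoeff`).

Multiplying a basis polynomial by `X` shows inductively that the leading coefficients of `ψ` and `ω`
are reciprocals of integers, equal up to sign to the denominators. Let `1/u` and `1/v` be those of
`Ψ` and `Ω` in degree `k`. The exponent of the maximal order over `ℤ[β]` divides the degree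
(`hasIntCoeffs_exponent_mul`), so `u ∣ n₁` and `v ∣ n₂` are coprime. A Bézout relation then writes
`γ k` as an integer combination of `Ψ` and `Ω` plus an element of `ℤ[X]`, whence integrality;
`mul_div_eq_one_or_neg_one` gives `lc(γ k) = ±1/(uv)`.

It remains to see that `uv · lc(P)` is an integer. Traces to `ℚ(α ^ n₂)` and `ℚ(α ^ n₁)` give `n₂ m
u · lc(P) ∈ ℤ` and `n₁ m v · lc(P) ∈ ℤ` (`IsTriangularBasis.extendPoly_denom`). Coprimality of `n₁,
n₂` removes those factors. The factor `m` disappears because `X ^ n - m` is Eisenstein at each prime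
dividing `m`, so such primes do not divide the denominator of `P`
(`exists_coprime_mul_hasIntCoeffs`). -/

/-! ### Rational polynomials with integer coefficients. -/

theorem hasIntCoeffs_iff {p : ℚ[X]} : HasIntCoeffs p ↔ ∀ i, ∃ z : ℤ, (z : ℚ) = p.coeff i := by
  have h := Polynomial.lifts_iff_coeff_lifts (f := Int.castRingHom ℚ) p
  rw [Polynomial.mem_lifts] at h
  simpa [HasIntCoeffs] using h

theorem HasIntCoeffs.add {p q : ℚ[X]} (hp : HasIntCoeffs p) (hq : HasIntCoeffs q) :
    HasIntCoeffs (p + q) := by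
  obtain ⟨a, rfl⟩ := hp
  obtain ⟨b, rfl⟩ := hq
  exact ⟨a + b, by simp⟩

theorem HasIntCoeffs.mul {p q : ℚ[X]} (hp : HasIntCoeffs p) (hq : HasIntCoeffs q) :
    HasIntCoeffs (p * q) := by
  obtain ⟨a, rfl⟩ := hp
  obtain ⟨b, rfl⟩ := hq
  exact ⟨a * b, by simp⟩

theorem hasIntCoeffs_C (z : ℤ) : HasIntCoeffs (C (z : ℚ)) := ⟨C z, by simp⟩

theorem hasIntCoeffs_X_pow (n : ℕ) : HasIntCoeffs (X ^ n : ℚ[X]) := ⟨X ^ n, by simp⟩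

theorem hasIntCoeffs_sum {ι : Type*} (s : Finset ι) (f : ι → ℚ[X])
    (h : ∀ i ∈ s, HasIntCoeffs (f i)) : HasIntCoeffs (∑ i ∈ s, f i) := by
  classical
  induction s using Finset.induction_on with
  | empty => exact ⟨0, by simp⟩
  | insert a s ha ih =>
    rw [Finset.sum_insert ha]
    exact (h a (by simp)).add (ih fun i hi => h i (by simp [hi]))

theorem HasIntCoeffs.leadingCoeff {p : ℚ[X]} (hp : HasIntCoeffs p) :
    ∃ z : ℤ, (z : ℚ) = p.leadingCoeff :=
  hasIntCoeffs_iff.1 hp _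

theorem HasIntCoeffs.isIntegral_aeval {p : ℚ[X]} (hp : HasIntCoeffs p) {β : ℂ}
    (hβ : IsIntegral ℤ β) : IsIntegral ℤ (aeval β p) := by
  obtain ⟨q, rfl⟩ := hp
  have : aeval β (q.map (Int.castRingHom ℚ)) = aeval β q := aeval_map_algebraMap ℚ β q
  rw [this]
  exact IsIntegral.of_mem_of_fg _ hβ.fg_adjoin_singleton _ (aeval_mem_adjoin_singleton ℤ β)

/-! ### Radicals of a square-free integer and their conjugates. -/

theorem isIntegral_radical {m : ℤ} {N : ℕ} (hN : N ≠ 0) {β : ℂ} (hβ : β ^ N = (m : ℂ)) :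
    IsIntegral ℤ β := by
  refine ⟨X ^ N - C m, monic_X_pow_sub_C m hN, ?_⟩
  rw [← aeval_def, map_sub, map_pow, aeval_X, aeval_C, hβ]
  simp

theorem exists_prime_dvd_radicand {m : ℤ} (hm1 : m ≠ 1) (hm2 : m ≠ -1) :
    ∃ p : ℤ, Prime p ∧ p ∣ m := by
  obtain ⟨p, hp, hpm⟩ := Int.exists_prime_and_dvd (n := m) (by
    intro h
    rcases Int.natAbs_eq_iff.1 h with h | h <;> simp_all)
  exact ⟨p, hp, hpm⟩

theorem isEisensteinAt_X_pow_sub_C {m p : ℤ} (hm : Squarefree m) (hp : Prime p) (hpm : p ∣ m)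
    {N : ℕ} (hN : N ≠ 0) : (X ^ N - C m : ℤ[X]).IsEisensteinAt (Submodule.span ℤ {p}) where
  leading := by
    rw [(monic_X_pow_sub_C m hN).leadingCoeff]
    intro h
    exact hp.not_dvd_one (Ideal.mem_span_singleton.1 h)
  mem := by
    intro k hk
    rw [natDegree_X_pow_sub_C] at hk
    refine Ideal.mem_span_singleton.2 ?_
    rw [coeff_sub, coeff_X_pow, if_neg hk.ne, coeff_C]
    split_ifs <;> simp [hpm]
  notMem := by
    rw [← Ideal.span, Ideal.span_singleton_pow, Ideal.mem_span_singleton]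
    intro h
    rw [coeff_sub, coeff_X_pow, if_neg hN.symm, coeff_C_zero, zero_sub, dvd_neg, sq] at h
    exact hp.not_isUnit (hm p h)

theorem minpoly_radical_eq_map {m : ℤ} (hm : Squarefree m) (hm1 : m ≠ 1) (hm2 : m ≠ -1)
    {N : ℕ} (hN : N ≠ 0) {β : ℂ} (hβ : β ^ N = (m : ℂ)) :
    minpoly ℚ β = (X ^ N - C m : ℤ[X]).map (Int.castRingHom ℚ) := by
  obtain ⟨p, hp, hpm⟩ := exists_prime_dvd_radicand hm1 hm2
  have hmon := monic_X_pow_sub_C m hN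
  have hirr : Irreducible (X ^ N - C m : ℤ[X]) :=
    (isEisensteinAt_X_pow_sub_C hm hp hpm hN).irreducible
      ((Ideal.span_singleton_prime hp.ne_zero).2 hp) hmon.isPrimitive
      (by rw [natDegree_X_pow_sub_C]; omega)
  refine (minpoly.eq_of_irreducible_of_monic
    ((hmon.irreducible_iff_irreducible_map_fraction_map (K := ℚ)).1 hirr) ?_
    (hmon.map _)).symm
  simp [hβ]

theorem minpoly_radical {m : ℤ} (hm : Squarefree m) (hm1 : m ≠ 1) (hm2 : m ≠ -1)
    {N : ℕ} (hN : N ≠ 0) {β : ℂ} (hβ : β ^ N = (m : ℂ)) :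
    minpoly ℚ β = X ^ N - C (m : ℚ) := by
  rw [minpoly_radical_eq_map hm hm1 hm2 hN hβ]
  simp

/-- Integrality of a rational polynomial expression in a radical does not depend on the choice of
the radical. -/
theorem isIntegral_aeval_conj {m : ℤ} (hm : Squarefree m) (hm1 : m ≠ 1) (hm2 : m ≠ -1)
    {N : ℕ} (hN : N ≠ 0) {β β' : ℂ} (hβ : β ^ N = (m : ℂ)) (hβ' : β' ^ N = (m : ℂ))
    {P : ℚ[X]} (h : IsIntegral ℤ (aeval β P)) : IsIntegral ℤ (aeval β' P) := by
  obtain ⟨f, hf, hf0⟩ := h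
  refine ⟨f, hf, ?_⟩
  -- The integral equation `f(P(β)) = 0` says that `β` is a root of `f ∘ P`; the conjugate `β'` has
  -- the same minimal polynomial, so it is a root too.
  have key : ∀ x : ℂ, eval₂ (algebraMap ℤ ℂ) (aeval x P) f =
      aeval x ((f.map (Int.castRingHom ℚ)).comp P) := by
    intro x
    rw [aeval_comp, ← aeval_def]
    exact (aeval_map_algebraMap ℚ _ f).symm
  rw [key] at hf0 ⊢
  have hd := minpoly.dvd ℚ β hf0
  rw [minpoly_radical hm hm1 hm2 hN hβ, ← minpoly_radical hm hm1 hm2 hN hβ'] at hd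
  obtain ⟨q, hq⟩ := hd
  rw [hq, map_mul, minpoly.aeval, zero_mul]

theorem eq_zero_of_aeval_radical_eq_zero {m : ℤ} (hm : Squarefree m) (hm1 : m ≠ 1)
    (hm2 : m ≠ -1) {N : ℕ} (hN : N ≠ 0) {β : ℂ} (hβ : β ^ N = (m : ℂ)) {P : ℚ[X]}
    (hP : P.degree < N) (h : aeval β P = 0) : P = 0 := by
  by_contra hne
  have := minpoly.degree_le_of_ne_zero ℚ β hne h
  rw [minpoly_radical hm hm1 hm2 hN hβ, degree_X_pow_sub_C (Nat.pos_of_ne_zero hN)] at this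
  exact absurd hP (not_lt.2 this)

theorem eq_of_aeval_radical_eq {m : ℤ} (hm : Squarefree m) (hm1 : m ≠ 1)
    (hm2 : m ≠ -1) {N : ℕ} (hN : N ≠ 0) {β : ℂ} (hβ : β ^ N = (m : ℂ)) {P Q : ℚ[X]}
    (hP : P.degree < N) (hQ : Q.degree < N) (h : aeval β P = aeval β Q) : P = Q :=
  sub_eq_zero.1 <| eq_zero_of_aeval_radical_eq_zero hm hm1 hm2 hN hβ
    ((degree_sub_le _ _).trans_lt (max_lt hP hQ)) (by rw [map_sub, h, sub_self])

/-- Every element of `ℚ(β)` is a polynomial expression of degree less than `N` in `β`. -/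
theorem exists_polynomial_of_mem_adjoin_radical {m : ℤ} {N : ℕ} (hN : N ≠ 0) {β : ℂ}
    (hβ : β ^ N = (m : ℂ)) {x : ℂ} (hx : x ∈ ℚ⟮β⟯) :
    ∃ P : ℚ[X], P.degree < N ∧ aeval β P = x := by
  have hint : IsIntegral ℚ β := (isIntegral_radical hN hβ).tower_top
  rw [← IntermediateField.mem_toSubalgebra, adjoin_simple_toSubalgebra_of_isAlgebraic hint.isAlgebraic,
    Algebra.adjoin_singleton_eq_range_aeval] at hx
  obtain ⟨P, rfl⟩ := hx
  have hmon := monic_X_pow_sub_C (m : ℚ) hN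
  refine ⟨P %ₘ (X ^ N - C (m : ℚ)), ?_, ?_⟩
  · rw [← degree_X_pow_sub_C (Nat.pos_of_ne_zero hN) (m : ℚ)]
    exact degree_modByMonic_lt _ hmon
  · rw [aeval_modByMonic_eq_self_of_root (by simp [hβ])]
    rfl

theorem aeval_mem_adjoin_radical (β : ℂ) (P : ℚ[X]) : aeval β P ∈ ℚ⟮β⟯ :=
  algebra_adjoin_le_adjoin ℚ _ (aeval_mem_adjoin_singleton ℚ β)

/-! ### Primes dividing `m` do not occur in denominators. -/

/-- The index of `ℤ[β]` in the ring of integers is not divisible by a prime factor of `m`. -/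
theorem hasIntCoeffs_of_prime_mul {m p : ℤ} (hm : Squarefree m) (hm1 : m ≠ 1)
    (hm2 : m ≠ -1) (hp : Prime p) (hpm : p ∣ m) {N : ℕ} (hN : N ≠ 0) {β : ℂ}
    (hβ : β ^ N = (m : ℂ)) {P : ℚ[X]} (hP : P.degree < N) (hPint : IsIntegral ℤ (aeval β P))
    (h : HasIntCoeffs (C (p : ℚ) * P)) : HasIntCoeffs P := by
  have hint : IsIntegral ℚ β := (isIntegral_radical hN hβ).tower_top
  have hinj : Function.Injective (algebraMap ℚ⟮β⟯ ℂ) := (algebraMap ℚ⟮β⟯ ℂ).injective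
  have hgenZ : IsIntegral ℤ (AdjoinSimple.gen ℚ β) :=
    (isIntegral_algebraMap_iff hinj).1 (isIntegral_radical hN hβ)
  set B := adjoin.powerBasis hint with hB
  have hgen : B.gen = AdjoinSimple.gen ℚ β := adjoin.powerBasis_gen hint
  have haev : ∀ Q : ℚ[X], algebraMap ℚ⟮β⟯ ℂ (aeval (AdjoinSimple.gen ℚ β) Q) = aeval β Q := by
    intro Q
    rw [← aeval_algebraMap_apply, AdjoinSimple.algebraMap_gen]
  have hmin : minpoly ℤ B.gen = X ^ N - C m := by
    have h1 := (IntermediateField.minpoly_gen ℚ β).symm.trans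
      (minpoly.isIntegrallyClosed_eq_field_fractions' ℚ hgenZ)
    rw [minpoly_radical_eq_map hm hm1 hm2 hN hβ] at h1
    rw [hgen]
    exact (map_injective _ (Int.castRingHom ℚ).injective_int h1).symm
  have hz : IsIntegral ℤ (aeval B.gen P) := by
    rw [hgen]
    refine (isIntegral_algebraMap_iff hinj).1 ?_
    rwa [haev]
  have hmem := mem_adjoin_of_smul_prime_smul_of_minpoly_isEisensteinAt (R := ℤ) (K := ℚ) (B := B)
    hp (hgen ▸ hgenZ) hz (by
      obtain ⟨q, hq⟩ := h
      have : p • aeval B.gen P = aeval B.gen q := by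
        have h2 := congrArg (aeval B.gen) hq
        rw [map_mul, aeval_C] at h2
        have h3 : aeval B.gen (q.map (Int.castRingHom ℚ)) = aeval B.gen q :=
          aeval_map_algebraMap ℚ _ q
        rw [h3] at h2
        rw [h2, zsmul_eq_mul]
        simp
      rw [this]
      exact aeval_mem_adjoin_singleton ℤ _) (by
      rw [hmin]
      exact isEisensteinAt_X_pow_sub_C hm hp hpm hN)
  rw [Algebra.adjoin_singleton_eq_range_aeval] at hmem
  obtain ⟨q, hq⟩ := hmem
  have hmon := monic_X_pow_sub_C m hN
  -- The polynomial `q` may have large degree. Its remainder by the monic `X ^ N - m` is still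
  -- integral, and in degree below `N` the value at `β` determines the polynomial.
  refine ⟨q %ₘ (X ^ N - C m), eq_of_aeval_radical_eq hm hm1 hm2 hN hβ ?_ hP ?_⟩
  · refine (degree_map_le).trans_lt ?_
    rw [← degree_X_pow_sub_C (Nat.pos_of_ne_zero hN) m]
    exact degree_modByMonic_lt _ hmon
  · have h1 : aeval β ((q %ₘ (X ^ N - C m)).map (Int.castRingHom ℚ)) =
      aeval β (q %ₘ (X ^ N - C m)) := aeval_map_algebraMap ℚ _ _
    rw [h1, aeval_modByMonic_eq_self_of_root (by simp [hβ]), ← haev P, ← hgen, ← hq]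
    have h2 : aeval (algebraMap ℚ⟮β⟯ ℂ B.gen) q = algebraMap ℚ⟮β⟯ ℂ (aeval B.gen q) :=
      aeval_algebraMap_apply ℂ B.gen q
    rw [hgen, AdjoinSimple.algebraMap_gen] at h2
    rw [h2, hgen]
    rfl

/-- The denominator of `P` itself serves as `s`: a prime common to it and `m` could be cancelled by
`hasIntCoeffs_of_prime_mul`, against minimality. -/
theorem exists_coprime_mul_hasIntCoeffs {m : ℤ} (hm : Squarefree m) (hm1 : m ≠ 1)
    (hm2 : m ≠ -1) {N : ℕ} (hN : N ≠ 0) {β : ℂ}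
    (hβ : β ^ N = (m : ℂ)) {P : ℚ[X]} (hP : P.degree < N) (hPint : IsIntegral ℤ (aeval β P)) :
    ∃ s : ℕ, IsCoprime (s : ℤ) m ∧ HasIntCoeffs (C (s : ℚ) * P) := by
  have hden := (polyDenom_isLeast P).1
  refine ⟨polyDenom P, ?_, hden.2⟩
  by_contra hcop
  rw [Int.isCoprime_iff_gcd_eq_one] at hcop
  obtain ⟨p, hp, hpd⟩ := Nat.exists_prime_and_dvd hcop
  have hpm : (p : ℤ) ∣ m := (Int.natCast_dvd_natCast.2 hpd).trans (Int.gcd_dvd_right _ _)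
  have hps : (p : ℤ) ∣ (polyDenom P : ℤ) :=
    (Int.natCast_dvd_natCast.2 hpd).trans (Int.gcd_dvd_left _ _)
  obtain ⟨c, hc⟩ := Int.natCast_dvd_natCast.1 hps
  have hc0 : 0 < c := by
    rcases Nat.eq_zero_or_pos c with rfl | h
    · simp at hc; have := hden.1; omega
    · exact h
  have hcP : HasIntCoeffs (C (c : ℚ) * P) := by
    refine hasIntCoeffs_of_prime_mul hm hm1 hm2 (Nat.prime_iff_prime_int.1 hp) hpm hN hβ
      ((degree_C_mul (by positivity)).trans_lt hP) ?_ ?_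
    · rw [map_mul, aeval_C]
      exact IsIntegral.mul (by simpa using isIntegral_algebraMap (R := ℤ) (A := ℂ) (x := (c : ℤ))) hPint
    · have := hden.2
      rw [hc] at this
      rw [← mul_assoc, ← C_mul]
      simpa using this
  have hle := (polyDenom_isLeast P).2 ⟨hc0, hcP⟩
  have := hp.two_le
  nlinarith

/-! ### Coefficient slices, traces and the exponent of the ring of integers. -/

/-- The polynomial `∑ i < f, p_(e i + j) X ^ i` collecting the coefficients of `p` whose index is
`j` modulo `e`. -/
noncomputable def coeffSlice (e f j : ℕ) (p : ℚ[X]) : ℚ[X] :=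
  ∑ i ∈ Finset.range f, C (p.coeff (e * i + j)) * X ^ i

theorem sum_range_mul_eq {A : Type*} [AddCommMonoid A] (e f : ℕ) (g : ℕ → A) :
    ∑ k ∈ Finset.range (e * f), g k =
      ∑ j ∈ Finset.range e, ∑ i ∈ Finset.range f, g (e * i + j) := by
  rw [Finset.sum_comm, mul_comm, ← Fin.sum_univ_eq_sum_range,
    ← finProdFinEquiv.sum_comp, Fintype.sum_prod_type, ← Fin.sum_univ_eq_sum_range]
  refine Finset.sum_congr rfl fun i _ => ?_
  rw [← Fin.sum_univ_eq_sum_range]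
  refine Finset.sum_congr rfl fun j _ => ?_
  simp [finProdFinEquiv, add_comm]

theorem eq_sum_coeffSlice {e f : ℕ} {p : ℚ[X]} (hp : p.degree < (e * f : ℕ)) :
    p = ∑ j ∈ Finset.range e, X ^ j * (coeffSlice e f j p).comp (X ^ e) := by
  by_cases h0 : p = 0
  · simp [h0, coeffSlice]
  conv_lhs => rw [p.as_sum_range_C_mul_X_pow' (natDegree_lt_iff_degree_lt h0 |>.2 hp)]
  rw [sum_range_mul_eq]
  refine Finset.sum_congr rfl fun j _ => ?_
  rw [coeffSlice, Polynomial.sum_comp, Finset.mul_sum]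
  refine Finset.sum_congr rfl fun i _ => ?_
  simp only [mul_comp, C_comp, X_pow_comp]
  ring

theorem degree_coeffSlice_lt (e f j : ℕ) (p : ℚ[X]) : (coeffSlice e f j p).degree < f := by
  refine (degree_sum_le _ _).trans_lt ((Finset.sup_lt_iff (WithBot.bot_lt_coe f)).2 ?_)
  intro i hi
  exact (degree_C_mul_X_pow_le _ _).trans_lt (Nat.cast_lt.2 (Finset.mem_range.1 hi))

theorem coeff_coeffSlice (e f j : ℕ) (p : ℚ[X]) {i : ℕ} (hi : i < f) :
    (coeffSlice e f j p).coeff i = p.coeff (e * i + j) := by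
  simp [coeffSlice, coeff_X_pow, hi]

theorem sum_pow_primitiveRoot {e : ℕ} {η : ℂ} (hη : IsPrimitiveRoot η e) (k : ℕ) :
    ∑ i ∈ Finset.range e, (η ^ i) ^ k = if e ∣ k then (e : ℂ) else 0 := by
  have hcomm : ∀ i, (η ^ i) ^ k = (η ^ k) ^ i := fun i => by rw [← pow_mul, ← pow_mul, mul_comm]
  simp_rw [hcomm]
  split_ifs with h
  · rw [(hη.pow_eq_one_iff_dvd k).2 h]
    simp
  · have h1 : η ^ k ≠ 1 := fun h1 => h ((hη.pow_eq_one_iff_dvd k).1 h1)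
    have h2 := mul_neg_geom_sum (η ^ k) e
    rw [← pow_mul, mul_comm k, pow_mul, hη.pow_eq_one, one_pow, sub_self] at h2
    exact (mul_eq_zero.1 h2).resolve_left (sub_ne_zero.2 h1.symm)

/-- If `P(α)` is integral, where `α ^ (e f) = m`, then so is `e m S(α ^ e)` for every slice `S` of
`P`: the trace from `ℚ(α)` to `ℚ(α ^ e)`, written as a sum over roots of unity. -/
theorem isIntegral_mul_aeval_coeffSlice {m : ℤ} (hm : Squarefree m) (hm1 : m ≠ 1) (hm2 : m ≠ -1)
    {e f : ℕ} (he : e ≠ 0) (hf : f ≠ 0) {α : ℂ} (hα : α ^ (e * f) = (m : ℂ)) {P : ℚ[X]}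
    (hP : P.degree < (e * f : ℕ)) (hint : IsIntegral ℤ (aeval α P)) {j : ℕ} (hj : j < e) :
    IsIntegral ℤ (aeval (α ^ e) (C ((e * m : ℤ) : ℚ) * coeffSlice e f j P)) := by
  have hN : e * f ≠ 0 := mul_ne_zero he hf
  obtain ⟨η, hη⟩ : ∃ η : ℂ, IsPrimitiveRoot η e := ⟨_, Complex.isPrimitiveRoot_exp e he⟩
  have hηe : ∀ i : ℕ, (η ^ i * α) ^ e = α ^ e := fun i => by
    rw [mul_pow, ← pow_mul, mul_comm i, pow_mul, hη.pow_eq_one, one_pow, one_mul]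
  have hηα : ∀ i : ℕ, (η ^ i * α) ^ (e * f) = (m : ℂ) := fun i => by
    rw [pow_mul, hηe, ← pow_mul, hα]
  have hle : j ≤ e * f := hj.le.trans (Nat.le_mul_of_pos_right e (Nat.pos_of_ne_zero hf))
  -- The weight `(η ^ i * α) ^ (e * f - j)` isolates slice `j`: slice `r` acquires the exponent `e *
  -- f - j + r`, which is a multiple of `e` only for `r = j`, where the power of `α` equals `m`.
  -- Using `e * f - j` instead of `-j` keeps the weight integral at the cost of the factor `m`.
  have hsum : IsIntegral ℤ (∑ i ∈ Finset.range e,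
      (η ^ i * α) ^ (e * f - j) * aeval (η ^ i * α) P) :=
    IsIntegral.sum _ fun i _ => ((isIntegral_radical hN (hηα i)).pow _).mul
      (isIntegral_aeval_conj hm hm1 hm2 hN hα (hηα i) hint)
  convert hsum using 1
  have hexp : ∀ i, aeval (η ^ i * α) P =
      ∑ r ∈ Finset.range e, (η ^ i * α) ^ r * aeval (α ^ e) (coeffSlice e f r P) := fun i => by
    conv_lhs => rw [eq_sum_coeffSlice hP]
    simp [aeval_comp, hηe]
  have hterm : ∀ r, ∑ i ∈ Finset.range e, (η ^ i * α) ^ (e * f - j) * ((η ^ i * α) ^ r *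
      aeval (α ^ e) (coeffSlice e f r P)) = (if e ∣ e * f - j + r then (e : ℂ) else 0) *
      (α ^ (e * f - j + r) * aeval (α ^ e) (coeffSlice e f r P)) := fun r => by
    rw [← sum_pow_primitiveRoot hη, Finset.sum_mul]
    refine Finset.sum_congr rfl fun i _ => ?_
    ring
  simp_rw [hexp, Finset.mul_sum]
  rw [Finset.sum_comm]
  simp_rw [hterm]
  rw [Finset.sum_eq_single_of_mem j (Finset.mem_range.2 hj)]
  · rw [Nat.sub_add_cancel hle, if_pos (dvd_mul_right e f), hα, map_mul, aeval_C]
    simp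
    ring
  · intro r hr hrj
    rw [if_neg, zero_mul]
    intro hd
    have hr' := Finset.mem_range.1 hr
    have h2 : (e : ℤ) ∣ (r : ℤ) - j := by
      have h3 : (e : ℤ) ∣ ((e * f - j + r : ℕ) : ℤ) := Int.natCast_dvd_natCast.2 hd
      push_cast [Nat.cast_sub hle] at h3
      have h4 : (r : ℤ) - j = (e * f - j + r) - e * f := by ring
      rw [h4]
      exact dvd_sub h3 (dvd_mul_right _ _)
    have := Int.eq_zero_of_abs_lt_dvd h2 (by rw [abs_lt]; constructor <;> omega)
    omega

theorem int_of_coprime_mul {q : ℚ} {a b : ℤ} (h : IsCoprime a b)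
    (ha : ∃ z : ℤ, (z : ℚ) = a * q) (hb : ∃ z : ℤ, (z : ℚ) = b * q) : ∃ z : ℤ, (z : ℚ) = q := by
  obtain ⟨s, t, hst⟩ := h
  obtain ⟨x, hx⟩ := ha
  obtain ⟨y, hy⟩ := hb
  refine ⟨s * x + t * y, ?_⟩
  have : (s * a + t * b : ℚ) = 1 := by exact_mod_cast hst
  push_cast
  rw [hx, hy]
  linear_combination q * this

/-- The exponent of the ring of integers of `ℚ(β)` modulo `ℤ[β]` divides `N`, if `β ^ N = m`. -/
theorem hasIntCoeffs_exponent_mul {m : ℤ} (hm : Squarefree m) (hm1 : m ≠ 1) (hm2 : m ≠ -1)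
    {N : ℕ} (hN : N ≠ 0) {β : ℂ} (hβ : β ^ N = (m : ℂ)) {P : ℚ[X]} (hP : P.degree < N)
    (hint : IsIntegral ℤ (aeval β P)) : HasIntCoeffs (C (N : ℚ) * P) := by
  rw [hasIntCoeffs_iff]
  intro j
  rw [coeff_C_mul]
  rcases le_or_gt N j with hj | hj
  · exact ⟨0, by rw [coeff_eq_zero_of_degree_lt (hP.trans_le (by exact_mod_cast hj))]; simp⟩
  obtain ⟨s, hs, hsP⟩ := exists_coprime_mul_hasIntCoeffs hm hm1 hm2 hN hβ hP hint
  obtain ⟨z, hz⟩ := hasIntCoeffs_iff.1 hsP j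
  rw [coeff_C_mul] at hz
  -- With `f = 1` each slice is a single coefficient, so `N * m * P.coeff j` is rational and
  -- integral, hence an integer. The multiplier `s` prime to `m` then removes `m`.
  have h1 := isIntegral_mul_aeval_coeffSlice hm hm1 hm2 (f := 1) hN one_ne_zero
    (by rwa [mul_one]) (by rwa [mul_one]) hint hj
  have h2 : C ((N * m : ℤ) : ℚ) * coeffSlice N 1 j P = C (((N * m : ℤ) : ℚ) * P.coeff j) := by
    simp [coeffSlice]
  rw [h2, aeval_C, isIntegral_algebraMap_iff (algebraMap ℚ ℂ).injective] at h1
  obtain ⟨y, hy⟩ := IsIntegrallyClosed.isIntegral_iff.1 h1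
  refine int_of_coprime_mul hs ⟨N * z, ?_⟩ ⟨y, ?_⟩
  · push_cast
    rw [hz]
    ring
  · change (y : ℚ) = _ at hy
    rw [hy]
    push_cast
    ring

/-! ### Triangular bases and leading coefficients. -/

/-- `ψ` is a family of polynomials, one of each degree less than `N`, whose values at `β` freely
generate the algebraic integers among the values at `β` of polynomials of degree less than `N`. -/
structure IsTriangularBasis {N : ℕ} (β : ℂ) (ψ : Fin N → ℚ[X]) : Prop where
  degree_eq : ∀ i, (ψ i).degree = (i : ℕ)
  isIntegral : ∀ i, IsIntegral ℤ (aeval β (ψ i))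
  exists_eq_sum : ∀ P : ℚ[X], P.degree < N → IsIntegral ℤ (aeval β P) →
    ∃ z : Fin N → ℤ, P = ∑ i, C (z i : ℚ) * ψ i

theorem degree_sum_triangular_lt {N : ℕ} {ψ : Fin N → ℚ[X]}
    (hψ : ∀ i, (ψ i).degree = (i : ℕ)) (z : Fin N → ℤ) :
    (∑ j, C (z j : ℚ) * ψ j).degree < N := by
  refine (degree_sum_le _ _).trans_lt ((Finset.sup_lt_iff (WithBot.bot_lt_coe N)).2 ?_)
  intro i _
  refine lt_of_le_of_lt ?_ (Nat.cast_lt.2 i.2 : ((i : ℕ) : WithBot ℕ) < N)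
  rw [← hψ i, ← smul_eq_C_mul]
  exact degree_smul_le _ _

theorem coeff_sum_triangular {N : ℕ} {ψ : Fin N → ℚ[X]} (hψ : ∀ i, (ψ i).degree = (i : ℕ))
    (z : Fin N → ℤ) (i : Fin N) (hz : ∀ j, i < j → z j = 0) :
    (∑ j, C (z j : ℚ) * ψ j).coeff i = z i * (ψ i).leadingCoeff := by
  rw [finsetSum_coeff, Finset.sum_eq_single i]
  · rw [coeff_C_mul, leadingCoeff, natDegree_eq_of_degree_eq_some (hψ i)]
  · intro j _ hji
    rw [coeff_C_mul]
    rcases lt_or_gt_of_ne hji with h | h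
    · rw [coeff_eq_zero_of_degree_lt, mul_zero]
      rw [hψ j]
      exact Nat.cast_lt.2 h
    · simp [hz j h]
  · simp

/-- Downward induction from the top index: once all later `z j` vanish, the coefficient of `X ^ i`
in the sum is `z i` times a nonzero leading coefficient. -/
theorem triangular_eq_zero {N : ℕ} {ψ : Fin N → ℚ[X]} (hψ : ∀ i, (ψ i).degree = (i : ℕ))
    (z : Fin N → ℤ) {K : ℕ} (hK : (∑ j, C (z j : ℚ) * ψ j).degree < K) (i : Fin N)
    (hi : K ≤ (i : ℕ)) : z i = 0 := by
  induction hn : N - (i : ℕ) using Nat.strong_induction_on generalizing i with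
  | _ n ih =>
    have hz : ∀ j, i < j → z j = 0 := fun j hj =>
      ih (N - (j : ℕ)) (by have := j.2; have : (i : ℕ) < j := hj; omega) j
        (hi.trans (le_of_lt hj)) rfl
    have h := coeff_sum_triangular hψ z i hz
    rw [coeff_eq_zero_of_degree_lt (hK.trans_le (Nat.cast_le.2 hi))] at h
    have hne : (ψ i).leadingCoeff ≠ 0 := by
      rw [leadingCoeff_ne_zero]
      rintro h0
      simpa [h0] using hψ i
    exact_mod_cast (mul_eq_zero.1 h.symm).resolve_right hne

theorem leadingCoeff_sum_triangular {N : ℕ} {ψ : Fin N → ℚ[X]}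
    (hψ : ∀ i, (ψ i).degree = (i : ℕ)) (z : Fin N → ℤ) (i : Fin N)
    (hi : (∑ j, C (z j : ℚ) * ψ j).degree = (i : ℕ)) :
    (∑ j, C (z j : ℚ) * ψ j).leadingCoeff = z i * (ψ i).leadingCoeff := by
  rw [← coeff_sum_triangular hψ z i fun j hj => triangular_eq_zero hψ z (K := i + 1) ?_ j hj,
    leadingCoeff, natDegree_eq_of_degree_eq_some hi]
  rw [hi]
  exact Nat.cast_lt.2 (Nat.lt_succ_self _)

theorem IsTriangularBasis.conj {m : ℤ} (hm : Squarefree m) (hm1 : m ≠ 1) (hm2 : m ≠ -1)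
    {N : ℕ} (hN : N ≠ 0) {β β' : ℂ} (hβ : β ^ N = (m : ℂ)) (hβ' : β' ^ N = (m : ℂ))
    {ψ : Fin N → ℚ[X]} (h : IsTriangularBasis β ψ) : IsTriangularBasis β' ψ where
  degree_eq := h.degree_eq
  isIntegral i := isIntegral_aeval_conj hm hm1 hm2 hN hβ hβ' (h.isIntegral i)
  exists_eq_sum P hP hint :=
    h.exists_eq_sum P hP (isIntegral_aeval_conj hm hm1 hm2 hN hβ' hβ hint)

theorem isIntegral_coe_iff {M : IntermediateField ℚ ℂ} {x : M} :
    IsIntegral ℤ (x : ℂ) ↔ IsIntegral ℤ x :=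
  isIntegral_algebraMap_iff (algebraMap M ℂ).injective

theorem IsIntegralBasis.isTriangularBasis {m : ℤ} (hm : Squarefree m) (hm1 : m ≠ 1)
    (hm2 : m ≠ -1) {N : ℕ} (hN : N ≠ 0) {β : ℂ} (hβ : β ^ N = (m : ℂ)) {ψ : Fin N → ℚ[X]}
    (hψ : ∀ i, (ψ i).degree = (i : ℕ))
    (h : IsIntegralBasis ℚ⟮β⟯ (fun i => aeval β (ψ i))) : IsTriangularBasis β ψ := by
  obtain ⟨B, hB⟩ := h
  refine ⟨hψ, fun i => ?_, fun P hP hint => ?_⟩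
  · have h1 := hB i
    simp only at h1
    rw [← h1]
    exact isIntegral_coe_iff.2 (RingOfIntegers.isIntegral_coe _)
  · have hmem : IsIntegral ℤ (⟨aeval β P, aeval_mem_adjoin_radical β P⟩ : ℚ⟮β⟯) :=
      isIntegral_coe_iff.1 hint
    set x : 𝓞 ℚ⟮β⟯ := ⟨_, hmem⟩ with hx
    refine ⟨fun i => B.repr x i, eq_of_aeval_radical_eq hm hm1 hm2 hN hβ hP ?_ ?_⟩
    · exact degree_sum_triangular_lt hψ _
    · have h1 := congrArg (fun y : 𝓞 ℚ⟮β⟯ => ((y : ℚ⟮β⟯) : ℂ)) (B.sum_repr x)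
      rw [map_sum]
      refine h1.symm.trans ?_
      push_cast
      refine Finset.sum_congr rfl fun i _ => ?_
      have h2 := hB i
      simp only at h2
      rw [map_mul, aeval_C, ← h2]
      simp

/-- Subtracting the integer multiple of `γ i` that cancels the leading term keeps the value integral
and lowers the degree, so descent on the degree expresses every integral value; independence follows
from the distinct degrees. -/
theorem isIntegralBasis_of_leadingCoeff {m : ℤ} (hm : Squarefree m) (hm1 : m ≠ 1)
    (hm2 : m ≠ -1) {N : ℕ} (hN : N ≠ 0) {β : ℂ} (hβ : β ^ N = (m : ℂ)) {γ : Fin N → ℚ[X]}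
    (hγ : ∀ i, (γ i).degree = (i : ℕ)) (hint : ∀ i, IsIntegral ℤ (aeval β (γ i)))
    (hlc : ∀ (i : Fin N) (P : ℚ[X]), P.degree = (i : ℕ) → IsIntegral ℤ (aeval β P) →
      ∃ z : ℤ, P.leadingCoeff = z * (γ i).leadingCoeff) :
    IsIntegralBasis ℚ⟮β⟯ (fun i => aeval β (γ i)) := by
  have hrep : ∀ (K : ℕ) (P : ℚ[X]), K ≤ N → P.degree < K → IsIntegral ℤ (aeval β P) →
      ∃ z : Fin N → ℤ, P = ∑ i, C (z i : ℚ) * γ i := by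
    intro K
    induction K with
    | zero =>
      intro P _ hP _
      refine ⟨0, ?_⟩
      have hP0 : P = 0 := by
        by_contra h0
        exact absurd hP (not_lt.2 (zero_le_degree_iff.2 h0))
      simp [hP0]
    | succ K ih =>
      intro P hK hP hPint
      rcases eq_or_ne P.degree (K : ℕ) with hdeg | hdeg
      · obtain ⟨y, hy⟩ := hlc ⟨K, hK⟩ P hdeg hPint
        obtain ⟨z, hz⟩ := ih (P - C (y : ℚ) * γ ⟨K, hK⟩) (by omega) (by
          have hγK := hγ ⟨K, hK⟩
          simp only at hγK
          have hy0 : (y : ℚ) ≠ 0 := by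
            intro h0
            rw [h0, zero_mul, leadingCoeff_eq_zero] at hy
            simp [hy] at hdeg
          rw [← hdeg]
          refine degree_sub_lt_left ?_ ?_ ?_
          · rw [degree_C_mul hy0, hγK, hdeg]
          · rintro rfl
            simp at hdeg
          · rw [leadingCoeff_mul, leadingCoeff_C, hy]) (by
          rw [map_sub, map_mul, aeval_C]
          refine hPint.sub (IsIntegral.mul ?_ (hint _))
          simpa using isIntegral_algebraMap (R := ℤ) (A := ℂ) (x := y))
        refine ⟨z + Pi.single ⟨K, hK⟩ y, ?_⟩
        have hs : ∑ i, C ((Pi.single (M := fun _ : Fin N => ℤ) ⟨K, hK⟩ y i : ℤ) : ℚ) * γ i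
            = C (y : ℚ) * γ ⟨K, hK⟩ := by
          rw [Finset.sum_eq_single ⟨K, hK⟩]
          · simp
          · intro j _ hj
            simp [hj]
          · simp
        simp only [Pi.add_apply, Int.cast_add, C_add, add_mul, Finset.sum_add_distrib]
        rw [← hz, hs]
        ring
      · refine ih P (by omega) (lt_of_le_of_ne ?_ hdeg) hPint
        rw [degree_le_iff_coeff_zero]
        intro k hk
        exact coeff_eq_zero_of_degree_lt (hP.trans_le (Nat.cast_le.2 (Nat.cast_lt.1 hk)))
  let x : Fin N → 𝓞 ℚ⟮β⟯ := fun i => ⟨⟨_, aeval_mem_adjoin_radical β (γ i)⟩,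
    isIntegral_coe_iff.1 (hint i)⟩
  have hx : ∀ i, ((x i : ℚ⟮β⟯) : ℂ) = aeval β (γ i) := fun i => rfl
  have hcoe : ∀ z : Fin N → ℤ, (((∑ i, z i • x i : 𝓞 ℚ⟮β⟯) : ℚ⟮β⟯) : ℂ) =
      aeval β (∑ i, C (z i : ℚ) * γ i) := by
    intro z
    rw [map_sum]
    push_cast
    refine Finset.sum_congr rfl fun i _ => ?_
    rw [map_mul, aeval_C]
    simp [hx]
  have hli : LinearIndependent ℤ x := by
    rw [Fintype.linearIndependent_iff]
    intro z hz i
    have h1 := hcoe z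
    rw [hz] at h1
    have h2 : ∑ i, C (z i : ℚ) * γ i = 0 := by
      refine eq_zero_of_aeval_radical_eq_zero hm hm1 hm2 hN hβ ?_ (h1.symm.trans (by simp))
      exact degree_sum_triangular_lt hγ _
    exact triangular_eq_zero hγ z (K := 0) (by rw [h2]; simp) i (Nat.zero_le _)
  refine ⟨Module.Basis.mk hli ?_, fun i => by rw [Module.Basis.mk_apply, hx]⟩
  intro y _
  obtain ⟨P, hP, hPy⟩ := exists_polynomial_of_mem_adjoin_radical hN hβ (y : ℚ⟮β⟯).2
  obtain ⟨z, hz⟩ := hrep N P le_rfl hP (by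
    rw [hPy]
    exact isIntegral_coe_iff.2 (RingOfIntegers.isIntegral_coe _))
  have : y = ∑ i, z i • x i := by
    apply RingOfIntegers.ext
    apply Subtype.ext
    rw [hcoe, ← hz, hPy]
  rw [this]
  exact Submodule.sum_mem _ fun i _ => Submodule.smul_mem _ _ (Submodule.subset_span ⟨i, rfl⟩)

/-! ### Denominators of triangular bases. -/

theorem polyDenom_eq_natAbs {p : ℚ[X]} {d : ℤ} (hd : d ≠ 0) (hlc : p.leadingCoeff = 1 / (d : ℚ))
    (hint : HasIntCoeffs (C (d : ℚ) * p)) : polyDenom p = d.natAbs := by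
  have hmem : 0 < d.natAbs ∧ HasIntCoeffs (C (d.natAbs : ℚ) * p) := by
    refine ⟨Int.natAbs_pos.2 hd, ?_⟩
    have h := (hasIntCoeffs_C d.sign).mul hint
    rw [← mul_assoc, ← C_mul, ← Int.cast_mul, Int.sign_mul_self_eq_natAbs, Int.cast_natCast] at h
    exact h
  refine le_antisymm ((polyDenom_isLeast p).2 hmem) ?_
  have hD := (polyDenom_isLeast p).1
  obtain ⟨z, hz⟩ := hD.2.leadingCoeff
  rw [leadingCoeff_mul, leadingCoeff_C, hlc, mul_one_div,
    eq_div_iff (by exact_mod_cast hd)] at hz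
  have hdvd : d ∣ (polyDenom p : ℤ) := ⟨z, by rw [mul_comm]; exact_mod_cast hz.symm⟩
  exact Nat.le_of_dvd hD.1 (Int.natAbs_dvd_natAbs.2 hdvd)

/-- The leading coefficient of a member of a triangular integral basis is, up to sign, the
reciprocal of its denominator. -/
theorem IsTriangularBasis.exists_denom {m : ℤ} {N : ℕ} (hN : N ≠ 0) {β : ℂ}
    (hβ : β ^ N = (m : ℂ)) {ψ : Fin N → ℚ[X]} (h : IsTriangularBasis β ψ)
    (h0 : ∀ i : Fin N, (i : ℕ) = 0 → ψ i = 1) (i : Fin N) :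
    ∃ d : ℤ, d ≠ 0 ∧ (ψ i).leadingCoeff = 1 / (d : ℚ) ∧
      ∀ j ≤ i, HasIntCoeffs (C (d : ℚ) * ψ j) := by
  obtain ⟨i, hi⟩ := i
  -- The claim covers all `j ≤ i` because the step needs one `d` clearing every earlier member at
  -- once.
  induction i with
  | zero =>
    refine ⟨1, one_ne_zero, by simp [h0 ⟨0, hi⟩ rfl], fun j hj => ?_⟩
    rw [h0 j (Nat.le_zero.1 hj)]
    exact ⟨1, by simp⟩
  | succ i ih =>
    have hi' : i < N := by omega
    obtain ⟨d, hd, hlc, hint⟩ := ih hi'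
    have hψi := h.degree_eq ⟨i, hi'⟩
    simp only at hψi
    have hdeg : (X * ψ ⟨i, hi'⟩).degree = ((i + 1 : ℕ) : WithBot ℕ) := by
      rw [degree_mul, degree_X, hψi]
      push_cast
      ring
    -- Comparing leading coefficients in this expansion gives `1 / d = z (i + 1) * lc (ψ (i + 1))`,
    -- so the next denominator is `d * z (i + 1)`.
    obtain ⟨z, hz⟩ := h.exists_eq_sum (X * ψ ⟨i, hi'⟩)
      (by rw [hdeg]; exact Nat.cast_lt.2 hi)
      (by rw [map_mul, aeval_X]; exact (isIntegral_radical hN hβ).mul (h.isIntegral _))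
    have hlc' := leadingCoeff_sum_triangular h.degree_eq z ⟨i + 1, hi⟩ (by rw [← hz, hdeg])
    rw [← hz, leadingCoeff_mul, leadingCoeff_X, one_mul, hlc] at hlc'
    have hdQ : (d : ℚ) ≠ 0 := by exact_mod_cast hd
    have hz0 : z ⟨i + 1, hi⟩ ≠ 0 := by
      intro hz0
      rw [hz0] at hlc'
      simp [hd] at hlc'
    have hzQ : (z ⟨i + 1, hi⟩ : ℚ) ≠ 0 := by exact_mod_cast hz0
    refine ⟨d * z ⟨i + 1, hi⟩, mul_ne_zero hd hz0, ?_, ?_⟩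
    · push_cast
      field_simp
      field_simp at hlc'
      linear_combination -hlc'
    · have hlow : ∀ j, j ≤ (⟨i, hi'⟩ : Fin N) →
          HasIntCoeffs (C ((d * z ⟨i + 1, hi⟩ : ℤ) : ℚ) * ψ j) := by
        intro j hj
        have h1 := (hasIntCoeffs_C (z ⟨i + 1, hi⟩)).mul (hint j hj)
        rw [← mul_assoc, ← C_mul, mul_comm (z _ : ℚ), ← Int.cast_mul] at h1
        exact h1
      intro j hj
      rcases hj.lt_or_eq with hj | rfl
      · exact hlow j (Nat.lt_succ_iff.1 hj)
      have hsplit := Finset.add_sum_erase Finset.univ (fun j => C (z j : ℚ) * ψ j)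
        (Finset.mem_univ (⟨i + 1, hi⟩ : Fin N))
      rw [← hz] at hsplit
      -- The expansion of `X * ψ i`, solved for its top term and multiplied by `d`; all remaining
      -- terms have index at most `i` or coefficient zero.
      have heq : C ((d * z ⟨i + 1, hi⟩ : ℤ) : ℚ) * ψ ⟨i + 1, hi⟩ =
          X ^ 1 * (C (d : ℚ) * ψ ⟨i, hi'⟩) + ∑ j ∈ Finset.univ.erase (⟨i + 1, hi⟩ : Fin N),
            C ((-z j : ℤ) : ℚ) * (C (d : ℚ) * ψ j) := by
        have : ∑ j ∈ Finset.univ.erase (⟨i + 1, hi⟩ : Fin N),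
            C ((-z j : ℤ) : ℚ) * (C (d : ℚ) * ψ j) = - C (d : ℚ) *
              ∑ j ∈ Finset.univ.erase (⟨i + 1, hi⟩ : Fin N), C (z j : ℚ) * ψ j := by
          rw [Finset.mul_sum]
          refine Finset.sum_congr rfl fun j _ => ?_
          push_cast
          rw [C_neg]
          ring
        rw [this]
        push_cast
        rw [C_mul]
        linear_combination C (d : ℚ) * hsplit
      rw [heq]
      refine ((hasIntCoeffs_X_pow 1).mul (hint _ le_rfl)).add (hasIntCoeffs_sum _ _ ?_)
      intro j hj
      rcases lt_or_ge (i + 1) (j : ℕ) with hlt | hle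
      · rw [triangular_eq_zero h.degree_eq z (K := i + 2)
          (by rw [← hz, hdeg]; exact Nat.cast_lt.2 (Nat.lt_succ_self _)) j hlt]
        exact ⟨0, by simp⟩
      · refine (hasIntCoeffs_C _).mul (hint j ?_)
        have : (j : ℕ) ≠ i + 1 := fun h => (Finset.mem_erase.1 hj).1 (Fin.ext h)
        exact Fin.le_def.2 (by simp only; omega)

/-! ### The extended families `X ^ j * ψ i (X ^ e)`. -/

theorem leadingCoeff_extendPoly {e j : ℕ} (he : e ≠ 0) (p : ℚ[X]) :
    (extendPoly e j p).leadingCoeff = p.leadingCoeff := by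
  rw [extendPoly, leadingCoeff_mul, leadingCoeff_X_pow, one_mul,
    leadingCoeff_comp (by rwa [natDegree_X_pow]), leadingCoeff_X_pow, one_pow, mul_one]

theorem degree_extendPoly {e j i : ℕ} (he : e ≠ 0) {p : ℚ[X]} (hp : p.degree = (i : ℕ)) :
    (extendPoly e j p).degree = ((e * i + j : ℕ) : WithBot ℕ) := by
  have hp0 : p ≠ 0 := by
    rintro rfl
    exact absurd hp WithBot.bot_ne_coe
  have hc0 : p.comp (X ^ e) ≠ 0 := by
    rw [← leadingCoeff_ne_zero, leadingCoeff_comp (by rwa [natDegree_X_pow]), leadingCoeff_X_pow,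
      one_pow, mul_one, leadingCoeff_ne_zero]
    exact hp0
  rw [extendPoly, degree_mul, degree_X_pow, degree_eq_natDegree hc0, natDegree_comp,
    natDegree_X_pow, natDegree_eq_of_degree_eq_some hp, ← Nat.cast_add]
  congr 1
  ring

theorem C_mul_extendPoly (c : ℚ) (e j : ℕ) (p : ℚ[X]) :
    C c * extendPoly e j p = extendPoly e j (C c * p) := by
  simp only [extendPoly, mul_comp, C_comp]
  ring

theorem HasIntCoeffs.extendPoly {p : ℚ[X]} (hp : HasIntCoeffs p) (e j : ℕ) :
    HasIntCoeffs (extendPoly e j p) := by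
  obtain ⟨q, rfl⟩ := hp
  exact ⟨X ^ j * q.comp (X ^ e), by simp [_root_.extendPoly, Polynomial.map_comp]⟩

theorem aeval_extendPoly (α : ℂ) (e j : ℕ) (p : ℚ[X]) :
    aeval α (extendPoly e j p) = α ^ j * aeval (α ^ e) p := by
  simp [extendPoly, aeval_comp]

theorem HasIntCoeffs.coeff {p : ℚ[X]} (hp : HasIntCoeffs p) (i : ℕ) :
    ∃ z : ℤ, (z : ℚ) = p.coeff i := hasIntCoeffs_iff.1 hp i

/-- The last clause bounds leading coefficients from one side. If `P` has degree `e * a + j`, its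
slice `j` has degree `a` and the same leading coefficient; by the trace argument `e * m` times this
slice is integral at `α ^ e`, so it expands in `ψ` and its leading coefficient lies in `ℤ · 1/d`. -/
theorem IsTriangularBasis.extendPoly_denom {m : ℤ} (hm : Squarefree m) (hm1 : m ≠ 1)
    (hm2 : m ≠ -1) {e f : ℕ} (he : e ≠ 0) (hf : f ≠ 0) {α β : ℂ} (hα : α ^ (e * f) = (m : ℂ))
    (hβ : β ^ f = (m : ℂ)) {ψ : Fin f → ℚ[X]} (h : IsTriangularBasis β ψ)
    (h0 : ∀ i : Fin f, (i : ℕ) = 0 → ψ i = 1) (a : Fin f) {j : ℕ} (hj : j < e) :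
    ∃ d : ℤ, d ≠ 0 ∧ d ∣ f ∧ (extendPoly e j (ψ a)).leadingCoeff = 1 / (d : ℚ) ∧
      HasIntCoeffs (C (d : ℚ) * extendPoly e j (ψ a)) ∧
      IsIntegral ℤ (aeval α (extendPoly e j (ψ a))) ∧
      ∀ P : ℚ[X], P.degree = ((e * a + j : ℕ) : WithBot ℕ) → IsIntegral ℤ (aeval α P) →
        ∃ z : ℤ, (z : ℚ) = ((e * m : ℤ) : ℚ) * (P.leadingCoeff * d) := by
  have hαe : (α ^ e) ^ f = (m : ℂ) := by rw [← pow_mul, hα]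
  -- `β` need not equal `α ^ e`, but both are `f`-th roots of `m`.
  have h' := h.conj hm hm1 hm2 hf hβ hαe
  obtain ⟨d, hd, hlc, hint⟩ := h.exists_denom hf hβ h0 a
  have hdQ : (d : ℚ) ≠ 0 := by exact_mod_cast hd
  refine ⟨d, hd, ?_, ?_, ?_, ?_, ?_⟩
  · have hfP := hasIntCoeffs_exponent_mul hm hm1 hm2 hf hβ
      (by rw [h.degree_eq a]; exact Nat.cast_lt.2 a.2) (h.isIntegral a)
    obtain ⟨z, hz⟩ := hfP.leadingCoeff
    rw [leadingCoeff_mul, leadingCoeff_C, hlc, mul_one_div, eq_div_iff hdQ] at hz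
    exact ⟨z, by rw [mul_comm]; exact_mod_cast hz.symm⟩
  · rw [leadingCoeff_extendPoly he, hlc]
  · rw [C_mul_extendPoly]
    exact (hint a le_rfl).extendPoly e j
  · rw [aeval_extendPoly]
    exact ((isIntegral_radical (mul_ne_zero he hf) hα).pow j).mul (h'.isIntegral a)
  · intro P hP hPint
    have hlt : e * a + j < e * f := by
      calc e * a + j < e * a + e := by omega
        _ = e * (a + 1) := by ring
        _ ≤ e * f := Nat.mul_le_mul_left e a.2
    have hS := isIntegral_mul_aeval_coeffSlice hm hm1 hm2 he hf hα
      (by rw [hP]; exact Nat.cast_lt.2 hlt) hPint hj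
    have hm0 : m ≠ 0 := hm.ne_zero
    have hem : ((e * m : ℤ) : ℚ) ≠ 0 := by
      exact_mod_cast mul_ne_zero (Nat.cast_ne_zero.2 he) hm0
    have hSlt : (C ((e * m : ℤ) : ℚ) * coeffSlice e f j P).degree < f := by
      rw [degree_C_mul hem]
      exact degree_coeffSlice_lt e f j P
    obtain ⟨z, hz⟩ := h'.exists_eq_sum _ hSlt hS
    have hPlc : P.coeff (e * a + j) = P.leadingCoeff := by
      rw [leadingCoeff, natDegree_eq_of_degree_eq_some hP]
    have hPne : P.leadingCoeff ≠ 0 := by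
      rw [leadingCoeff_ne_zero]
      rintro rfl
      exact absurd hP WithBot.bot_ne_coe
    have hcoeff : (coeffSlice e f j P).coeff a = P.leadingCoeff := by
      rw [coeff_coeffSlice _ _ _ _ a.2, hPlc]
    have hSdeg : (C ((e * m : ℤ) : ℚ) * coeffSlice e f j P).degree = (a : ℕ) := by
      rw [degree_C_mul hem]
      refine le_antisymm ?_ (le_degree_of_ne_zero (by rwa [hcoeff]))
      rw [degree_le_iff_coeff_zero]
      intro i hi
      have hi' : (a : ℕ) < i := Nat.cast_lt.1 hi
      rcases lt_or_ge i f with hif | hif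
      · rw [coeff_coeffSlice _ _ _ _ hif]
        refine coeff_eq_zero_of_degree_lt ?_
        rw [hP]
        exact Nat.cast_lt.2 (Nat.add_lt_add_right
          (Nat.mul_lt_mul_of_pos_left hi' (Nat.pos_of_ne_zero he)) j)
      · exact coeff_eq_zero_of_degree_lt
          ((degree_coeffSlice_lt e f j P).trans_le (Nat.cast_le.2 hif))
    have hlead := leadingCoeff_sum_triangular h.degree_eq z a (by rw [← hz, hSdeg])
    have hSlc : (coeffSlice e f j P).leadingCoeff = P.leadingCoeff := by
      rw [degree_C_mul hem] at hSdeg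
      rw [leadingCoeff, natDegree_eq_of_degree_eq_some hSdeg, hcoeff]
    rw [← hz, leadingCoeff_mul, leadingCoeff_C, hSlc, hlc] at hlead
    refine ⟨z a, ?_⟩
    rw [← mul_assoc, hlead]
    field_simp

/-- Since the degree is `e * a + b` with `b < e`, this is division of `k` by `e` with remainder. -/
theorem existsUnique_degree_extendPoly {e f : ℕ} {ψ : Fin f → ℚ[X]}
    (hψ : ∀ i, (ψ i).degree = (i : ℕ)) {k : ℕ} (hk : k < f * e) :
    ∃! ab : Fin f × Fin e, (extendPoly e ab.2 (ψ ab.1)).degree = k := by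
  have he : e ≠ 0 := by
    rintro rfl
    simp at hk
  have key : ∀ ab : Fin f × Fin e, (extendPoly e ab.2 (ψ ab.1)).degree = k ↔
      finProdFinEquiv ab = ⟨k, hk⟩ := by
    intro ab
    rw [degree_extendPoly he (hψ ab.1), Fin.ext_iff, Nat.cast_inj]
    simp [finProdFinEquiv, add_comm]
  simp_rw [key]
  exact finProdFinEquiv.bijective.existsUnique _

/-! ### Leading coefficients of admissible polynomials and the main theorem. -/

/-- The arithmetic behind the normalization of the leading coefficients. -/
theorem mul_div_eq_one_or_neg_one {d₁ d₂ N : ℤ} (h₁ : d₁ ≠ 0) (h₂ : d₂ ≠ 0) (hN : N ≠ 0)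
    (hx : ∃ x : ℤ, (x : ℚ) = (d₂.natAbs : ℚ) * (1 / N) - 1 / d₁)
    (hy : ∃ y : ℤ, (y : ℚ) = (d₁.natAbs : ℚ) * (1 / N) - 1 / d₂) :
    (d₁ * d₂ : ℚ) * (1 / N) = 1 ∨ (d₁ * d₂ : ℚ) * (1 / N) = -1 := by
  obtain ⟨x, hx⟩ := hx
  obtain ⟨y, hy⟩ := hy
  have h₁Q : (d₁ : ℚ) ≠ 0 := by exact_mod_cast h₁
  have h₂Q : (d₂ : ℚ) ≠ 0 := by exact_mod_cast h₂
  have hNQ : (N : ℚ) ≠ 0 := by exact_mod_cast hN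
  have habs : ∀ d : ℤ, ∃ ε : ℤ, ε * ε = 1 ∧ (d.natAbs : ℚ) = ε * d := by
    intro d
    rw [Nat.cast_natAbs]
    rcases abs_choice d with h | h <;> rw [h]
    · exact ⟨1, by simp⟩
    · exact ⟨-1, by simp⟩
  obtain ⟨ε₁, hε₁, hd₁⟩ := habs d₁
  obtain ⟨ε₂, hε₂, hd₂⟩ := habs d₂
  rw [hd₂] at hx
  rw [hd₁] at hy
  have hε₁Q : (ε₁ * ε₁ : ℚ) = 1 := by exact_mod_cast hε₁
  have hε₂Q : (ε₂ * ε₂ : ℚ) = 1 := by exact_mod_cast hε₂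
  have hw₁ : (d₁ * d₂ : ℚ) * (1 / N) = ε₂ * (d₁ * x + 1) := by
    rw [hx]
    field_simp
    linear_combination -(d₁ * d₂) * hε₂Q
  have hw₂ : (d₁ * d₂ : ℚ) * (1 / N) = ε₁ * (d₂ * y + 1) := by
    rw [hy]
    field_simp
    linear_combination -(d₁ * d₂) * hε₁Q
  have hw : ε₂ * (d₁ * x + 1) = ε₁ * (d₂ * y + 1) := by exact_mod_cast hw₁.symm.trans hw₂
  set w := ε₂ * (d₁ * x + 1) with hwdef
  have hwN : d₁ * d₂ = w * N := by
    have : (d₁ * d₂ : ℚ) = w * N := by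
      rw [hwdef]
      push_cast
      rw [← hw₁]
      field_simp
    exact_mod_cast this
  -- The two expressions for `w` make it coprime to `d₁` and to `d₂`, while `w` divides `d₁ * d₂`;
  -- hence `w` is a unit.
  have hc₁ : IsCoprime w d₁ := ⟨ε₂, -x, by rw [hwdef]; linear_combination (d₁ * x + 1) * hε₂⟩
  have hc₂ : IsCoprime w d₂ := ⟨ε₁, -y, by rw [hw]; linear_combination (d₂ * y + 1) * hε₁⟩
  have hu : IsUnit w := (hc₁.mul_right hc₂).isUnit_of_dvd' dvd_rfl ⟨N, hwN⟩
  have hwQ : (d₁ * d₂ : ℚ) * (1 / N) = (w : ℚ) := by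
    rw [hw₁, hwdef]
    push_cast
    ring
  rw [hwQ]
  rcases Int.isUnit_iff.1 hu with h | h <;> simp [h]

theorem mainTheorem2 (m : ℤ) (hm : Squarefree m) (hm1 : m ≠ 1) (hm2 : m ≠ -1)
    (n₁ n₂ : ℕ) (hn₁ : 2 ≤ n₁) (hn₂ : 2 ≤ n₂) (hn : Nat.Coprime n₁ n₂)
    (α α₁ α₂ : ℂ) (hα : α ^ (n₁ * n₂) = (m : ℂ)) (hα₁ : α₁ ^ n₁ = (m : ℂ))
    (hα₂ : α₂ ^ n₂ = (m : ℂ))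
    (ψ : Fin n₁ → ℚ[X]) (ω : Fin n₂ → ℚ[X])
    (hψ0 : ∀ i : Fin n₁, (i : ℕ) = 0 → ψ i = 1) (hω0 : ∀ i : Fin n₂, (i : ℕ) = 0 → ω i = 1)
    (hψdeg : ∀ i : Fin n₁, (ψ i).degree = (i : ℕ)) (hωdeg : ∀ i : Fin n₂, (ω i).degree = (i : ℕ))
    (hψ : IsIntegralBasis ℚ⟮α₁⟯ (fun i => aeval α₁ (ψ i)))
    (hω : IsIntegralBasis ℚ⟮α₂⟯ (fun i => aeval α₂ (ω i))) :
    -- the members of degree `k` of the two extended families exist and are unique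
    (∀ k : ℕ, k < n₁ * n₂ →
      (∃! ab : Fin n₁ × Fin n₂, (extendPoly n₂ ab.2 (ψ ab.1)).degree = k) ∧
      (∃! cd : Fin n₂ × Fin n₁, (extendPoly n₁ cd.2 (ω cd.1)).degree = k)) ∧
    -- every choice of the combined polynomials gives an integral basis
    (∀ γ : Fin (n₁ * n₂) → ℚ[X], (∀ k : Fin (n₁ * n₂), IsCRTCombination ψ ω k (γ k)) →
      IsIntegralBasis ℚ⟮α⟯ (fun k => aeval α (γ k))) ∧
    -- such a choice exists once the leading coefficients are normalized to be positive
    ((∀ i, 0 < (ψ i).leadingCoeff) → (∀ i, 0 < (ω i).leadingCoeff) →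
      ∃ γ : Fin (n₁ * n₂) → ℚ[X], ∀ k : Fin (n₁ * n₂), IsCRTCombination ψ ω k (γ k)) := by
  have h₁ : n₁ ≠ 0 := by omega
  have h₂ : n₂ ≠ 0 := by omega
  have hα' : α ^ (n₂ * n₁) = (m : ℂ) := by rwa [mul_comm]
  have hψT := hψ.isTriangularBasis hm hm1 hm2 h₁ hα₁ hψdeg
  have hωT := hω.isTriangularBasis hm hm1 hm2 h₂ hα₂ hωdeg
  have hcop : IsCoprime (n₁ : ℤ) (n₂ : ℤ) := Nat.isCoprime_iff_coprime.2 hn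
  have huniq : ∀ k : ℕ, k < n₁ * n₂ →
      (∃! ab : Fin n₁ × Fin n₂, (extendPoly n₂ ab.2 (ψ ab.1)).degree = k) ∧
      (∃! cd : Fin n₂ × Fin n₁, (extendPoly n₁ cd.2 (ω cd.1)).degree = k) := fun k hk =>
    ⟨existsUnique_degree_extendPoly hψdeg hk,
      existsUnique_degree_extendPoly hωdeg (by rwa [mul_comm])⟩
  refine ⟨huniq, fun γ hγ => ?_, fun hψpos hωpos => ?_⟩
  · have hlocal : ∀ k : Fin (n₁ * n₂), IsIntegral ℤ (aeval α (γ k)) ∧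
        ∀ P : ℚ[X], P.degree = (k : ℕ) → IsIntegral ℤ (aeval α P) →
          ∃ z : ℤ, P.leadingCoeff = z * (γ k).leadingCoeff := by
      intro k
      obtain ⟨⟨⟨a, b⟩, hab, -⟩, ⟨⟨c, d⟩, hcd, -⟩⟩ := huniq k k.2
      simp only at hab hcd
      obtain ⟨u, hu, hudvd, hulc, huint, hΨint, hΨ⟩ :=
        hψT.extendPoly_denom hm hm1 hm2 h₂ h₁ hα' hα₁ hψ0 a b.2
      obtain ⟨v, hv, hvdvd, hvlc, hvint, hΩint, hΩ⟩ :=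
        hωT.extendPoly_denom hm hm1 hm2 h₁ h₂ hα hα₂ hω0 c d.2
      rw [← degree_extendPoly h₂ (hψdeg a), hab] at hΨ
      rw [← degree_extendPoly h₁ (hωdeg c), hcd] at hΩ
      have huv : IsCoprime u v :=
        (hcop.of_isCoprime_of_dvd_left hudvd).of_isCoprime_of_dvd_right hvdvd
      obtain ⟨hγΨ, hγΩ⟩ := (hγ k).sub_mem a b c d hab hcd
      rw [polyDenom_eq_natAbs hv hvlc hvint] at hγΨ
      rw [polyDenom_eq_natAbs hu hulc huint] at hγΩ
      have hγlc : (γ k).coeff k = (γ k).leadingCoeff := by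
        rw [leadingCoeff, natDegree_eq_of_degree_eq_some (hγ k).degree_eq]
      refine ⟨?_, fun P hP hPint => ?_⟩
      · have hαint := isIntegral_radical (mul_ne_zero h₁ h₂) hα
        have huv' : IsCoprime (u.natAbs : ℤ) (v.natAbs : ℤ) :=
          Nat.isCoprime_iff_coprime.2 (Int.isCoprime_iff_gcd_eq_one.1 huv)
        obtain ⟨s, t, hst⟩ := huv'
        have hstQ : C ((s : ℚ) * u.natAbs + t * v.natAbs) = 1 := by
          rw [← C_1]
          congr 1
          have := congrArg (Int.cast : ℤ → ℚ) hst
          rwa [Int.cast_add, Int.cast_mul, Int.cast_mul, Int.cast_natCast, Int.cast_natCast,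
            Int.cast_one] at this
        -- Bézout with the absolute values, which are the actual denominators: the bracketed
        -- differences lie in `ℤ[X]`, and the rest is an integer combination of `Ψ` and `Ω`.
        have hdecomp : γ k = C (t : ℚ) * (C (v.natAbs : ℚ) * γ k - extendPoly n₂ b (ψ a)) +
            C (s : ℚ) * (C (u.natAbs : ℚ) * γ k - extendPoly n₁ d (ω c)) +
            (C (t : ℚ) * extendPoly n₂ b (ψ a) + C (s : ℚ) * extendPoly n₁ d (ω c)) := by
          rw [C_add, C_mul, C_mul] at hstQ
          linear_combination -γ k * hstQ
        rw [hdecomp, map_add, map_add (aeval α) (C (t : ℚ) * extendPoly _ _ _),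
          map_mul (aeval α) (C (t : ℚ)) (extendPoly _ _ _),
          map_mul (aeval α) (C (s : ℚ)) (extendPoly _ _ _)]
        have hC : ∀ z : ℤ, IsIntegral ℤ (aeval α (C (z : ℚ))) := fun z =>
          (hasIntCoeffs_C z).isIntegral_aeval hαint
        exact ((((hasIntCoeffs_C t).mul hγΨ).add
          ((hasIntCoeffs_C s).mul hγΩ)).isIntegral_aeval hαint).add
          (((hC t).mul hΨint).add ((hC s).mul hΩint))
      · obtain ⟨N, hN, hγN⟩ := (hγ k).leadingCoeff_eq
        have hΨlc : (extendPoly n₂ b (ψ a)).coeff k = 1 / u := by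
          rw [← hulc, leadingCoeff, natDegree_eq_of_degree_eq_some hab]
        have hΩlc : (extendPoly n₁ d (ω c)).coeff k = 1 / v := by
          rw [← hvlc, leadingCoeff, natDegree_eq_of_degree_eq_some hcd]
        have hx := hγΨ.coeff k
        have hy := hγΩ.coeff k
        rw [coeff_sub, coeff_C_mul, hγlc, hΨlc, hγN] at hx
        rw [coeff_sub, coeff_C_mul, hγlc, hΩlc, hγN] at hy
        have hunit := mul_div_eq_one_or_neg_one hu hv hN hx hy
        rw [← hγN] at hunit
        obtain ⟨s, hs, hsP⟩ := exists_coprime_mul_hasIntCoeffs hm hm1 hm2 (mul_ne_zero h₁ h₂) hα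
          (by rw [hP]; exact Nat.cast_lt.2 k.2) hPint
        obtain ⟨z, hz⟩ := hsP.leadingCoeff
        rw [leadingCoeff_mul, leadingCoeff_C] at hz
        obtain ⟨x, hx⟩ := hΨ P hP hPint
        obtain ⟨y, hy⟩ := hΩ P hP hPint
        -- Multiplying the two trace bounds by `v` and `u` leaves the common quantity `m * lc(P) * u
        -- * v` with the coprime factors `n₂` and `n₁`.
        have hmul : ∃ w : ℤ, (w : ℚ) = (m : ℤ) * (P.leadingCoeff * u * v) :=
          int_of_coprime_mul hcop
            ⟨u * y, by push_cast; push_cast at hy; rw [hy]; ring⟩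
            ⟨v * x, by push_cast; push_cast at hx; rw [hx]; ring⟩
        obtain ⟨w, hw⟩ := int_of_coprime_mul hs
          ⟨u * v * z, by push_cast; rw [hz]; ring⟩ hmul
        rcases hunit with h | h
        · exact ⟨w, by rw [hw]; linear_combination -P.leadingCoeff * h⟩
        · exact ⟨-w, by push_cast; rw [hw]; linear_combination P.leadingCoeff * h⟩
    exact isIntegralBasis_of_leadingCoeff hm hm1 hm2 (mul_ne_zero h₁ h₂) hα
      (fun k => (hγ k).degree_eq) (fun k => (hlocal k).1) (fun k => (hlocal k).2)
  · suffices hex : ∀ k : Fin (n₁ * n₂), ∃ g : ℚ[X], IsCRTCombination ψ ω k g from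
      ⟨fun k => (hex k).choose, fun k => (hex k).choose_spec⟩
    intro k
    obtain ⟨⟨⟨a, b⟩, hab, hab'⟩, ⟨⟨c, d⟩, hcd, hcd'⟩⟩ := huniq k k.2
    simp only at hab hcd
    obtain ⟨u, hu, hudvd, hulc, huint, -, -⟩ :=
      hψT.extendPoly_denom hm hm1 hm2 h₂ h₁ hα' hα₁ hψ0 a b.2
    obtain ⟨v, hv, hvdvd, hvlc, hvint, -, -⟩ :=
      hωT.extendPoly_denom hm hm1 hm2 h₁ h₂ hα hα₂ hω0 c d.2
    have huv : IsCoprime u v :=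
      (hcop.of_isCoprime_of_dvd_left hudvd).of_isCoprime_of_dvd_right hvdvd
    -- Positivity identifies the denominators with `u` and `v` themselves, not just up to sign, as
    -- the Bézout construction of `g` requires.
    have hupos : 0 < u := by
      have := hψpos a
      rw [← leadingCoeff_extendPoly h₂ (j := b), hulc, one_div_pos] at this
      exact_mod_cast this
    have hvpos : 0 < v := by
      have := hωpos c
      rw [← leadingCoeff_extendPoly h₁ (j := d), hvlc, one_div_pos] at this
      exact_mod_cast this
    have huD : (polyDenom (extendPoly n₂ b (ψ a)) : ℚ) = u := by
      rw [polyDenom_eq_natAbs hu hulc huint, Nat.cast_natAbs, abs_of_pos hupos]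
    have hvD : (polyDenom (extendPoly n₁ d (ω c)) : ℚ) = v := by
      rw [polyDenom_eq_natAbs hv hvlc hvint, Nat.cast_natAbs, abs_of_pos hvpos]
    have huQ : (u : ℚ) ≠ 0 := by exact_mod_cast hu
    have hvQ : (v : ℚ) ≠ 0 := by exact_mod_cast hv
    obtain ⟨s, t, hst⟩ := huv
    have hstQ : (s * u + t * v : ℚ) = 1 := by exact_mod_cast hst
    have hstC : C (s : ℚ) * C (u : ℚ) + C (t : ℚ) * C (v : ℚ) = 1 := by
      rw [← C_mul, ← C_mul, ← C_add, hstQ, C_1]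
    set Ψ := extendPoly n₂ b (ψ a) with hΨdef
    set Ω := extendPoly n₁ d (ω c) with hΩdef
    -- The Bézout coefficients are crossed: with `s * u + t * v = 1`, the leading coefficient is `t
    -- / u + s / v = 1 / (u * v)`.
    set g := C (t : ℚ) * Ψ + C (s : ℚ) * Ω with hg
    have hΨlc : Ψ.coeff k = 1 / u := by
      rw [← hulc, leadingCoeff, natDegree_eq_of_degree_eq_some hab]
    have hΩlc : Ω.coeff k = 1 / v := by
      rw [← hvlc, leadingCoeff, natDegree_eq_of_degree_eq_some hcd]
    have hgk : g.coeff k = 1 / ((u * v : ℤ) : ℚ) := by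
      rw [hg, coeff_add, coeff_C_mul, coeff_C_mul, hΨlc, hΩlc]
      push_cast
      field_simp
      linear_combination hstQ
    have hgdeg : g.degree = (k : ℕ) := by
      refine le_antisymm ?_ (le_degree_of_ne_zero ?_)
      · refine (degree_add_le _ _).trans (max_le ?_ ?_)
        · rw [← smul_eq_C_mul, ← hab]
          exact degree_smul_le _ _
        · rw [← smul_eq_C_mul, ← hcd]
          exact degree_smul_le _ _
      · rw [hgk]
        push_cast
        positivity
    refine ⟨g, hgdeg, ⟨u * v, mul_ne_zero hu hv, ?_⟩, fun a' b' c' d' hab₁ hcd₁ => ?_⟩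
    · rw [leadingCoeff, natDegree_eq_of_degree_eq_some hgdeg, hgk]
    · obtain ⟨rfl, rfl⟩ := Prod.ext_iff.1 (hab' (a', b') hab₁)
      obtain ⟨rfl, rfl⟩ := Prod.ext_iff.1 (hcd' (c', d') hcd₁)
      simp only at hΨdef hΩdef
      rw [← hΨdef, ← hΩdef, huD, hvD]
      constructor
      · have h : C (v : ℚ) * g - Ψ =
            C ((-s : ℤ) : ℚ) * (C (u : ℚ) * Ψ) + C (s : ℚ) * (C (v : ℚ) * Ω) := by
          rw [hg]
          push_cast
          rw [C_neg]
          linear_combination Ψ * hstC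
        rw [h]
        exact ((hasIntCoeffs_C _).mul huint).add ((hasIntCoeffs_C _).mul hvint)
      · have h : C (u : ℚ) * g - Ω =
            C (t : ℚ) * (C (u : ℚ) * Ψ) + C ((-t : ℤ) : ℚ) * (C (v : ℚ) * Ω) := by
          rw [hg]
          push_cast
          rw [C_neg]
          linear_combination Ω * hstC
        rw [h]
        exact ((hasIntCoeffs_C _).mul huint).add ((hasIntCoeffs_C _).mul hvint)
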